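/- All graphs are finite and simple. A graph is chordal if it has no induced cycle of length at least $4$. A set $R$ of vertices of a connected graph $G$ is a resolving set if for any two distinct vertices $u,v$ of $G$ there is $x\in R$ with $d_G(x,u)\neq d_G(x,v)$. A tree decomposition of $G$ is a tree $T$ whose vertices (the bags) are subsets of $V(G)$, such that every vertex of $G$ lies in a bag, the two ends of every edge of $G$ lie in a common bag, and $X\cap Z\subseteq Y$ whenever the bag $Y$ lies on the path of $T$ from $X$ to $Z$; its width is $\max_X(|X|-1)$ over the bags $X$, and the treewidth of $G$ is the minimum width of a tree decomposition of $G$. There are absolute constants $C$, $C'$ and $c$ such that the following holds. Let $G$ be a connected chordal graph with $n\ge 2$ vertices, diameter $d$, treewidth $w$ and a resolving set of size $k$. Then $$n\le C\,k\,d^2\,3^{3w+1},\qquad w\le 3^k,\qquad\text{and}\qquad n\le C'\,d^2\,2^{2^{ck}}.$$ That is, $n=\mathcal{O}(kd^2 3^{3w+1})$ and $n=\mathcal{O}(d^2 2^{2^{\mathcal{O}(k)}})$. -/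

import Mathlib

universe u

namespace SimpleGraph

variable {V : Type u}

/-- A graph is chordal if it has no induced cycle of length at least four. -/
def IsChordal (G : SimpleGraph V) : Prop :=
  ∀ n : ℕ, 4 ≤ n → ¬ (cycleGraph n).IsIndContained G

/-- A set `R` of vertices of a connected graph is resolving if any two distinct vertices are at
different distances from some vertex of `R`. -/
def IsResolvingSet (G : SimpleGraph V) (R : Finset V) : Prop :=
  ∀ u v : V, u ≠ v → ∃ x ∈ R, G.dist x u ≠ G.dist x v

/-- A tree decomposition of `G`: a tree whose vertices (the bags) are finite subsets of `V`. -/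
structure TreeDecomposition (G : SimpleGraph V) where
  /-- The set of bags. -/
  bags : Finset (Finset V)
  /-- The tree on the bags. -/
  tree : SimpleGraph {X : Finset V // X ∈ bags}
  isTree : tree.IsTree
  /-- The bags cover the vertices. -/
  vertex_mem : ∀ v : V, ∃ X ∈ bags, v ∈ X
  /-- Both ends of each edge lie in a common bag. -/
  edge_mem : ∀ u v : V, G.Adj u v → ∃ X ∈ bags, u ∈ X ∧ v ∈ X
  /-- If `Y` lies on the path from `X` to `Z` in the tree, then `X ∩ Z ⊆ Y`. -/
  inter_subset : ∀ (X Y Z : {X : Finset V // X ∈ bags}) (p : tree.Walk X Z), p.IsPath →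
    Y ∈ p.support → ∀ v : V, v ∈ X.1 → v ∈ Z.1 → v ∈ Y.1

/-- The width of a tree decomposition: the maximum of `|X| - 1` over the bags `X`. -/
def TreeDecomposition.width {G : SimpleGraph V} (D : G.TreeDecomposition) : ℕ :=
  D.bags.sup fun X => X.card - 1

/-- The treewidth of a finite graph: the minimum width of a tree decomposition. -/
noncomputable def treewidth (G : SimpleGraph V) : ℕ :=
  sInf (Set.range fun D : G.TreeDecomposition => D.width)

end SimpleGraph

/-! A chordal graph has a perfect elimination ordering. Each vertex with its later neighbours forms
a clique, its bag; taking the earliest later neighbour as parent turns the vertices into a rooted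
tree, and the bags along it form a tree decomposition (`EliminationTree`). Every clique lies in a
bag of any tree decomposition, so these bags have at most `w + 1` vertices. A resolving vertex sees
at most two distances on a clique, so they also have at most `2 ^ k`, whence `w ≤ 2 ^ k ≤ 3 ^ k`.

For the order, let the trace of a node be the set of resolving vertices below it. The nonempty
traces are laminar, so there are at most `2 * k` of them. Assign each vertex to the trace of its
nearest ancestor with nonempty trace. The nodes with a given trace lie on a path of the tree, and
the bags of its two ends separate the class from `R` (`exists_classes`). Hence, within a class, a
vertex is determined by its distances to two cliques, and each clique allows at most `(d + 1) * 2 ^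
(w + 1)` distance profiles (`exists_profile`). This gives `n ≤ 2 * k * ((d + 1) * 2 ^ (w + 1)) ^ 2`,
which is stronger than required; the last bound follows by inserting `w ≤ 3 ^ k`. -/

namespace SimpleGraph

variable {V : Type u} {G : SimpleGraph V}

/-! ### Chordal graphs and perfect elimination orderings -/

theorem cycleGraph_adj_iff_of_lt {n : ℕ} {i j : Fin n} (h : i < j) :
    (cycleGraph n).Adj i j ↔ i.val + 1 = j.val ∨ (i.val = 0 ∧ j.val + 1 = n) := by
  have hij : i.val < j.val := h
  have hj := j.isLt
  have h1 : (i - j).val = n - j.val + i.val := by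
    rw [Fin.sub_def]
    exact Nat.mod_eq_of_lt (by omega)
  have h2 : (j - i).val = j.val - i.val := Fin.sub_val_of_le h.le
  rw [cycleGraph_adj', h1, h2]
  omega

theorem cycleGraph_isIndContained {n : ℕ} (f : ℕ → V)
    (hne : ∀ i j, i < j → j < n → f i ≠ f j)
    (hadj : ∀ i j, i < j → j < n → (G.Adj (f i) (f j) ↔ i + 1 = j ∨ (i = 0 ∧ j + 1 = n))) :
    (cycleGraph n).IsIndContained G := by
  refine ⟨⟨⟨fun i => f i, fun i j hij => ?_⟩, fun {i j} => ?_⟩⟩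
  · rcases lt_trichotomy i j with h | h | h
    · exact (hne _ _ h j.isLt hij).elim
    · exact h
    · exact (hne _ _ h i.isLt hij.symm).elim
  · change G.Adj (f i) (f j) ↔ _
    rcases lt_trichotomy i j with h | h | h
    · rw [cycleGraph_adj_iff_of_lt h, hadj _ _ h j.isLt]
    · simp [h]
    · rw [G.adj_comm, (cycleGraph n).adj_comm, cycleGraph_adj_iff_of_lt h, hadj _ _ h i.isLt]

theorem Connected.induce_insert {A : Set V} (hA : (G.induce A).Connected) {s a : V} (ha : a ∈ A)
    (h : G.Adj s a) : (G.induce (insert s A)).Connected := by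
  have := induce_union_connected (G := G) hA.preconnected
    (induce_pair_connected_of_adj h).preconnected ⟨a, ha, by simp⟩
  have e : A ∪ {s, a} = insert s A := by
    ext x; simp only [Set.mem_union, Set.mem_insert_iff, Set.mem_singleton_iff]
    constructor
    · rintro (h | h | h) <;> simp_all
    · rintro (h | h) <;> simp_all
  rw [e] at this
  exact this

theorem Walk.dist_getVert_of_length_eq_dist {u v : V} (p : G.Walk u v) (hp : p.length = G.dist u v)
    {i : ℕ} (hi : i ≤ p.length) : G.dist u (p.getVert i) = i := by
  have h1 : G.dist u (p.getVert i) ≤ i := (dist_le (p.take i)).trans (by simp)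
  obtain ⟨q, hq⟩ := (p.take i).reachable.exists_walk_length_eq_dist
  have h2 := dist_le (q.append (p.drop i))
  rw [Walk.length_append, hq, Walk.drop_length] at h2
  omega

/-- In a chordal graph, two common neighbours of `b` that both attach to a connected set without
neighbours of `b` are adjacent. -/
theorem IsChordal.adj_of_common_neighbor (hG : G.IsChordal) {A : Set V}
    (hA : (G.induce A).Connected) {s t b : V} (hs : ∃ a ∈ A, G.Adj s a) (ht : ∃ a ∈ A, G.Adj t a)
    (hb : ∀ a ∈ A, ¬ G.Adj a b) (hbA : b ∉ A) (hsb : G.Adj s b) (htb : G.Adj t b) (hst : s ≠ t) :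
    G.Adj s t := by
  by_contra hn
  obtain ⟨a, ha, hsa⟩ := hs
  obtain ⟨a', ha', hta⟩ := ht
  have hH := (hA.induce_insert ha hsa).induce_insert (Set.mem_insert_of_mem s ha') hta
  set W : Set V := insert t (insert s A) with hW
  let s' : W := ⟨s, by simp [hW]⟩
  let t' : W := ⟨t, by simp [hW]⟩
  obtain ⟨p, hp⟩ := hH.exists_walk_length_eq_dist s' t'
  have hdist : ∀ i ≤ p.length, (G.induce W).dist s' (p.getVert i) = i :=
    fun i hi => p.dist_getVert_of_length_eq_dist hp hi
  have hinj : ∀ i j, i ≤ p.length → j ≤ p.length → (p.getVert i).1 = (p.getVert j).1 → i = j := by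
    intro i j hi hj h
    rw [← hdist i hi, ← hdist j hj, Subtype.ext h]
  have h0 : p.length ≠ 0 := fun h => hst (congrArg Subtype.val (Walk.eq_of_length_eq_zero h))
  have h1 : p.length ≠ 1 := fun h =>
    hn (show (G.induce W).Adj s' t' from Walk.adj_of_length_eq_one h)
  have hmem : ∀ i, 0 < i → i < p.length → (p.getVert i).1 ∈ A := by
    intro i hi hi'
    rcases (p.getVert i).2 with h | h | h
    · have := hinj i p.length hi'.le le_rfl (by rw [h, Walk.getVert_length])
      omega
    · have := hinj i 0 hi'.le (Nat.zero_le _) (by rw [h, Walk.getVert_zero])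
      omega
    · exact h
  have hbW : ∀ x : W, x.1 ≠ b := by
    rintro ⟨x, h | h | h⟩ rfl
    · subst h; exact htb.ne rfl
    · subst h; exact hsb.ne rfl
    · exact hbA h
  -- A shortest path from `s` to `t` through `A` has length at least 2; closing it with `b` gives an
  -- induced cycle on `p.length + 2` vertices.
  refine hG (p.length + 2) (by omega) (cycleGraph_isIndContained
    (fun i => if i ≤ p.length then (p.getVert i).1 else b) ?_ ?_)
  · intro i j hij hj
    have hi : i ≤ p.length := by omega
    simp only [hi, if_true]
    split_ifs with h
    · exact fun e => hij.ne (hinj _ _ hi h e)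
    · exact hbW _
  · intro i j hij hj
    have hi : i ≤ p.length := by omega
    simp only [hi, if_true]
    split_ifs with h
    · constructor
      · intro hadj
        have hadj' : (G.induce W).Adj (p.getVert i) (p.getVert j) := hadj
        have := hadj'.diff_dist_adj (u := s')
        rw [hdist i hi, hdist j h] at this
        omega
      · intro h'
        have : i + 1 = j := by omega
        subst this
        exact p.adj_getVert_succ (by omega)
    · have hj' : j = p.length + 1 := by omega
      subst hj'
      constructor
      · intro hadj
        by_contra hcon
        exact hb _ (hmem i (by omega) (by omega)) hadj
      · rintro (h' | ⟨h', -⟩)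
        · have : i = p.length := by omega
          subst this
          rw [Walk.getVert_length]; exact htb
        · subst h'
          rw [Walk.getVert_zero]; exact hsb

/-- Every nonempty vertex set of a finite chordal graph has a vertex that is simplicial in it. -/
theorem IsChordal.exists_simplicial [Finite V] (hG : G.IsChordal) (U : Set V) (hU : U.Nonempty) :
    ∃ v ∈ U, G.IsClique {x | x ∈ U ∧ G.Adj v x} := by
  induction hn : U.ncard using Nat.strong_induction_on generalizing U with
  | _ n ih =>
  -- A maximal `A` in `F` has boundary `S` and far side `B`. Maximality joins `S` completely to `B`,
  -- chordality then makes `S` a clique, and a vertex simplicial in `B` stays simplicial in `U`. If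
  -- `F` is empty, `U` is a clique.
  let F : Set (Set V) := {A | A ⊆ U ∧ (G.induce A).Connected ∧ ∃ b ∈ U, b ∉ A ∧ ∀ a ∈ A, ¬ G.Adj a b}
  by_cases hF : F.Nonempty
  · obtain ⟨A, hAF⟩ := (Set.toFinite F).exists_maximal hF
    obtain ⟨⟨hAU, hA, b₀, hb₀U, hb₀A, hb₀⟩, hmax⟩ := hAF
    let B : Set V := {b | b ∈ U ∧ b ∉ A ∧ ∀ a ∈ A, ¬ G.Adj a b}
    let S : Set V := {s | s ∈ U ∧ s ∉ A ∧ ∃ a ∈ A, G.Adj s a}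
    have hSB : ∀ s ∈ S, ∀ b ∈ B, G.Adj s b := by
      rintro s ⟨hsU, hsA, a, ha, hsa⟩ b ⟨hbU, hbA, hb⟩
      by_contra hsb
      have hbs : b ≠ s := by
        rintro rfl
        exact hb a ha hsa.symm
      have : insert s A ∈ F := by
        refine ⟨Set.insert_subset hsU hAU, hA.induce_insert ha hsa, b, hbU, ?_, ?_⟩
        · rintro (h | h)
          · exact hbs h
          · exact hbA h
        · rintro x (rfl | hx)
          · exact hsb
          · exact hb x hx
      exact hsA (hmax this (Set.subset_insert s A) (Set.mem_insert s A))
    have hS : G.IsClique S := by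
      intro s hs t ht hst
      exact hG.adj_of_common_neighbor hA hs.2.2 ht.2.2 hb₀ hb₀A (hSB s hs b₀ ⟨hb₀U, hb₀A, hb₀⟩)
        (hSB t ht b₀ ⟨hb₀U, hb₀A, hb₀⟩) hst
    have hBU : B ⊂ U := by
      refine ⟨fun x hx => hx.1, fun h => ?_⟩
      obtain ⟨⟨a, ha⟩⟩ := hA.nonempty
      exact (h (hAU ha)).2.1 ha
    obtain ⟨v, hv, hvc⟩ := ih _ (hn ▸ Set.ncard_lt_ncard hBU) B ⟨b₀, hb₀U, hb₀A, hb₀⟩ rfl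
    have hsplit : ∀ x ∈ U, G.Adj v x → x ∈ B ∨ x ∈ S := by
      intro x hx hvx
      have hxA : x ∉ A := fun h => hv.2.2 x h hvx.symm
      by_cases h : ∃ a ∈ A, G.Adj x a
      · exact Or.inr ⟨hx, hxA, h⟩
      · exact Or.inl ⟨hx, hxA, fun a ha hax => h ⟨a, ha, hax.symm⟩⟩
    refine ⟨v, hv.1, ?_⟩
    rintro x ⟨hx, hvx⟩ y ⟨hy, hvy⟩ hxy
    rcases hsplit x hx hvx with hx' | hx' <;> rcases hsplit y hy hvy with hy' | hy'
    · exact hvc ⟨hx', hvx⟩ ⟨hy', hvy⟩ hxy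
    · exact (hSB y hy' x hx').symm
    · exact hSB x hx' y hy'
    · exact hS hx' hy' hxy
  · have hall : ∀ x ∈ U, ∀ y ∈ U, x ≠ y → G.Adj x y := by
      intro x hx y hy hxy
      by_contra hadj
      refine hF ⟨{x}, by simpa using hx, ?_, y, hy, by simpa using hxy.symm, by simpa using hadj⟩
      exact connected_iff_exists_forall_reachable _ |>.2
        ⟨⟨x, rfl⟩, fun w => by rw [Subsingleton.elim w ⟨x, rfl⟩]⟩
    obtain ⟨v, hv⟩ := hU
    exact ⟨v, hv, fun x hx y hy hxy => hall x hx.1 y hy.1 hxy⟩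

/-- A finite chordal graph has a perfect elimination ordering. -/
theorem IsChordal.exists_elimination_ordering [Finite V] (hG : G.IsChordal) :
    ∃ f : V → ℕ, f.Injective ∧ ∀ v, G.IsClique {x | f v < f x ∧ G.Adj v x} := by
  have key : ∀ (n : ℕ) (U : Set V), U.ncard = n → ∃ f : V → ℕ, Set.InjOn f U ∧
      ∀ v ∈ U, G.IsClique {x | x ∈ U ∧ f v < f x ∧ G.Adj v x} := by
    classical
    intro n
    induction n with
    | zero =>
      intro U hU
      rw [Set.ncard_eq_zero] at hU
      subst hU
      exact ⟨fun _ => 0, by simp, by simp⟩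
    | succ n ih =>
      intro U hU
      obtain ⟨v, hv, hvc⟩ := hG.exists_simplicial U
        (Set.nonempty_of_ncard_ne_zero (by omega))
      obtain ⟨f, hf, hfc⟩ := ih (U \ {v}) (by rw [Set.ncard_sdiff_singleton_of_mem hv, hU]; rfl)
      refine ⟨fun x => if x = v then 0 else f x + 1, ?_, ?_⟩
      · intro x hx y hy hxy
        dsimp only at hxy
        split_ifs at hxy with h1 h2 h2
        · rw [h1, h2]
        · exact hf ⟨hx, h1⟩ ⟨hy, h2⟩ (by omega)
      · intro x hx
        by_cases h : x = v
        · subst h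
          refine hvc.subset ?_
          exact fun y hy => ⟨hy.1, hy.2.2⟩
        · refine (hfc x ⟨hx, h⟩).subset ?_
          rintro y ⟨hy, hlt, hadj⟩
          dsimp only at hlt
          rw [if_neg h] at hlt
          split_ifs at hlt with h'
          · omega
          exact ⟨⟨hy, h'⟩, by omega, hadj⟩
  obtain ⟨f, hf, hfc⟩ := key _ Set.univ rfl
  refine ⟨f, fun x y h => hf trivial trivial h, fun v => ?_⟩
  refine (hfc v trivial).subset ?_
  exact fun x hx => ⟨trivial, hx⟩

end SimpleGraph

/-! ### Cliques against tree decompositions and resolving sets -/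

namespace SimpleGraph

variable {V : Type u} {G : SimpleGraph V}

theorem Walk.IsPath.append_of_disjoint {u v w : V} {p : G.Walk u v} {q : G.Walk v w}
    (hp : p.IsPath) (hq : q.IsPath) (h : ∀ x ∈ p.support, x ∈ q.support → x = v) :
    (p.append q).IsPath := by
  rw [Walk.isPath_def, Walk.support_append, List.nodup_append']
  refine ⟨hp.support_nodup, hq.support_nodup.tail, fun x hx hx' => ?_⟩
  obtain rfl := h x hx (List.mem_of_mem_tail hx')
  have := hq.support_nodup
  rw [← Walk.cons_tail_support, List.nodup_cons] at this
  exact this.1 hx'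

/-- Every clique of `G` is contained in a bag of any tree decomposition. -/
theorem TreeDecomposition.exists_clique_subset_bag (D : G.TreeDecomposition) {K : Finset V}
    (hK : G.IsClique (K : Set V)) : ∃ X ∈ D.bags, K ⊆ X := by
  classical
  have hconn := D.isTree.connected
  obtain ⟨X₀⟩ := hconn.nonempty
  obtain ⟨X, hX, hmax⟩ := D.bags.exists_max_image (fun X => (K ∩ X).card) ⟨X₀.1, X₀.2⟩
  refine ⟨X, hX, fun v hv => ?_⟩
  by_contra hvX
  obtain ⟨Y₀, hY₀, hvY₀⟩ := D.vertex_mem v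
  let x : {X : Finset V // X ∈ D.bags} := ⟨X, hX⟩
  -- The bag `y` nearest to `x` among those containing `v` contradicts the choice of `X`: for `u` in
  -- `K ∩ X` and a bag `z` containing `u` and `v`, the tree path from `x` to `z` runs through `y`,
  -- so `u` lies in `y`.
  obtain ⟨y, hy, hymin⟩ := (Finset.univ.filter
    (fun y : {X : Finset V // X ∈ D.bags} => v ∈ y.1)).exists_min_image (fun y => D.tree.dist x y)
    ⟨⟨Y₀, hY₀⟩, by simpa using hvY₀⟩
  simp only [Finset.mem_filter, Finset.mem_univ, true_and] at hy hymin
  obtain ⟨p, hp, hpl⟩ := hconn.exists_path_of_dist x y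
  have hpv : ∀ z ∈ p.support, v ∈ z.1 → z = y := by
    intro z hz hvz
    have h1 := hymin z hvz
    have h2 := dist_le (p.takeUntil z hz)
    have h3 := congrArg Walk.length (p.take_spec hz)
    rw [Walk.length_append] at h3
    exact Walk.eq_of_length_eq_zero (p := p.dropUntil z hz) (by omega)
  have hsub : insert v (K ∩ X) ⊆ K ∩ y.1 := by
    intro u hu
    rw [Finset.mem_insert, Finset.mem_inter] at hu
    rw [Finset.mem_inter]
    rcases hu with rfl | ⟨huK, huX⟩
    · exact ⟨hv, hy⟩
    · refine ⟨huK, ?_⟩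
      have huv : u ≠ v := by rintro rfl; exact hvX huX
      obtain ⟨Z, hZ, huZ, hvZ⟩ := D.edge_mem u v (hK huK hv huv)
      let z : {X : Finset V // X ∈ D.bags} := ⟨Z, hZ⟩
      obtain ⟨q, hq, -⟩ := hconn.exists_path_of_dist y z
      have hpq : (p.append q).IsPath := hp.append_of_disjoint hq fun a ha ha' =>
        hpv a ha (D.inter_subset y a z q hq ha' v hy hvZ)
      exact D.inter_subset x y z _ hpq (by simp) u huX huZ
  have h1 := hmax y.1 y.2
  have h2 := Finset.card_le_card hsub
  rw [Finset.card_insert_of_notMem (fun h => hvX (Finset.mem_inter.1 h).2)] at h2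
  omega

/-- Some decomposition must exist, since otherwise the infimum defining `treewidth` would be 0 by
convention. -/
theorem card_le_treewidth_add_one [Nonempty G.TreeDecomposition] {K : Finset V}
    (hK : G.IsClique (K : Set V)) : K.card ≤ G.treewidth + 1 := by
  obtain ⟨D, hD⟩ := Nat.sInf_mem (Set.range_nonempty fun D : G.TreeDecomposition => D.width)
  obtain ⟨X, hX, hKX⟩ := D.exists_clique_subset_bag hK
  have h1 : X.card - 1 ≤ D.width := Finset.le_sup (f := fun X : Finset V => X.card - 1) hX
  have h2 := Finset.card_le_card hKX
  have h3 : G.treewidth = D.width := hD.symm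
  omega

/-- On a clique, the distances from a fixed vertex take at most two consecutive values. -/
theorem IsClique.exists_dist {K : Finset V} (hK : G.IsClique (K : Set V))
    (v : V) : ∃ m, (m = 0 ∨ ∃ z ∈ K, G.dist v z = m) ∧
      ∀ z ∈ K, G.dist v z = m ∨ G.dist v z = m + 1 := by
  -- The alternative `m = 0` covers the empty clique and keeps `m` bounded by the diameter.
  rcases K.eq_empty_or_nonempty with rfl | hne
  · exact ⟨0, by simp⟩
  obtain ⟨z₀, hz₀, hmin⟩ := K.exists_min_image (fun z => G.dist v z) hne
  refine ⟨G.dist v z₀, Or.inr ⟨z₀, hz₀, rfl⟩, fun z hz => ?_⟩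
  by_cases h : z₀ = z
  · subst h; exact Or.inl rfl
  · have := (hK hz₀ hz h).diff_dist_adj (u := v)
    have := hmin z hz
    omega

/-- A clique in a graph with a resolving set of size `k` has at most `2 ^ k` vertices. -/
theorem IsResolvingSet.card_clique_le {R : Finset V} (hR : G.IsResolvingSet R) {K : Finset V}
    (hK : G.IsClique (K : Set V)) : K.card ≤ 2 ^ R.card := by
  classical
  choose m _ hm using hK.exists_dist
  rw [← Finset.card_powerset]
  -- Each `r` splits `K` into its nearer and farther vertices, and a vertex of `K` is determined by
  -- its sides.
  refine Finset.card_le_card_of_injOn (fun v => R.filter fun r => G.dist r v = m r)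
    (fun v _ => Finset.mem_coe.2 (Finset.mem_powerset.2 (Finset.filter_subset _ _))) ?_
  intro u hu v hv huv
  by_contra hne
  obtain ⟨r, hr, hd⟩ := hR u v hne
  have h : G.dist r u = m r ↔ G.dist r v = m r := by
    have := congrArg (r ∈ ·) huv
    simpa [hr] using this
  have h1 := hm r u hu
  have h2 := hm r v hv
  omega

end SimpleGraph

/-! ### The elimination tree and its tree decomposition -/

namespace SimpleGraph

variable {V : Type u} {G : SimpleGraph V}

/-- A rooted tree on the vertices of `G`, each vertex carrying a clique (its bag), as given by a
perfect elimination ordering. -/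
structure EliminationTree (G : SimpleGraph V) where
  /-- The position of a vertex in the ordering. -/
  rank : V → ℕ
  /-- The parent in the tree; the root is its own parent. -/
  parent : V → V
  /-- The root. -/
  root : V
  /-- The clique carried by a vertex. -/
  bag : V → Finset V
  rank_injective : rank.Injective
  rank_le_root : ∀ v, rank v ≤ rank root
  parent_root : parent root = root
  rank_lt_parent : ∀ v, v ≠ root → rank v < rank (parent v)
  self_mem_bag : ∀ v, v ∈ bag v
  isClique_bag : ∀ v, G.IsClique (bag v : Set V)
  rank_le_of_mem_bag : ∀ v, ∀ u ∈ bag v, rank v ≤ rank u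
  mem_bag_parent : ∀ v, ∀ u ∈ bag v, u ≠ v → u ∈ bag (parent v)
  adj_mem_bag : ∀ u v, G.Adj u v → v ∈ bag u ∨ u ∈ bag v

theorem IsChordal.nonempty_eliminationTree [Fintype V] [Nonempty V] (hG : G.IsChordal) :
    Nonempty G.EliminationTree := by
  classical
  obtain ⟨f, hf, hfc⟩ := hG.exists_elimination_ordering
  obtain ⟨ρ, -, hρ⟩ := (Finset.univ : Finset V).exists_max_image f Finset.univ_nonempty
  let N : V → Finset V := fun v => Finset.univ.filter fun x => f v < f x ∧ G.Adj v x
  have hNρ : ∀ x, x ∉ N ρ := by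
    intro x hx
    have h1 := (Finset.mem_filter.1 hx).2.1
    have h2 := hρ x (Finset.mem_univ x)
    omega
  have hex : ∀ v, ∃ p, (v = ρ → p = ρ) ∧ (v ≠ ρ → f v < f p) ∧
      ∀ u ∈ N v, u = p ∨ u ∈ N p := by
    intro v
    by_cases h : (N v).Nonempty
    · obtain ⟨p, hp, hmin⟩ := (N v).exists_min_image f h
      have hp' := (Finset.mem_filter.1 hp).2
      refine ⟨p, ?_, fun _ => hp'.1, fun u hu => ?_⟩
      · rintro rfl
        exact (hNρ _ hp).elim
      · by_cases hup : u = p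
        · exact Or.inl hup
        · right
          have hu' := (Finset.mem_filter.1 hu).2
          refine Finset.mem_filter.2 ⟨Finset.mem_univ _, ?_, hfc v hp' hu' (Ne.symm hup)⟩
          exact lt_of_le_of_ne (hmin u hu) fun h => hup (hf h).symm
    -- A vertex without later neighbours hangs directly under the root, whether or not they are
    -- adjacent in `G`.
    · rw [Finset.not_nonempty_iff_eq_empty] at h
      refine ⟨ρ, fun _ => rfl, fun hv => ?_, by simp [h]⟩
      exact lt_of_le_of_ne (hρ v (Finset.mem_univ v)) fun h => hv (hf h)
  choose p hp1 hp2 hp3 using hex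
  refine ⟨⟨f, p, ρ, fun v => insert v (N v), hf, fun v => hρ v (Finset.mem_univ v), hp1 ρ rfl, hp2,
    fun v => Finset.mem_insert_self _ _, ?_, ?_, ?_, ?_⟩⟩
  · intro v
    rw [Finset.coe_insert, isClique_insert]
    refine ⟨(hfc v).subset fun x hx => (Finset.mem_filter.1 hx).2, fun b hb _ => ?_⟩
    exact (Finset.mem_filter.1 hb).2.2
  · intro v u hu
    rcases Finset.mem_insert.1 hu with rfl | hu
    · exact le_rfl
    · exact (Finset.mem_filter.1 hu).2.1.le
  · intro v u hu huv
    exact Finset.mem_insert.2 (hp3 v u ((Finset.mem_insert.1 hu).resolve_left huv))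
  · intro u v huv
    rcases lt_trichotomy (f u) (f v) with h | h | h
    · exact Or.inl (Finset.mem_insert_of_mem (Finset.mem_filter.2 ⟨Finset.mem_univ _, h, huv⟩))
    · exact (huv.ne (hf h)).elim
    · exact Or.inr (Finset.mem_insert_of_mem (Finset.mem_filter.2 ⟨Finset.mem_univ _, h, huv.symm⟩))

namespace EliminationTree

variable (T : G.EliminationTree)

/-- A vertex is the lowest-ranked member of its bag. Since the nodes of a `TreeDecomposition` are
the bags themselves, this lets vertices serve as nodes. -/
theorem bag_injective : T.bag.Injective := by
  intro u v h
  refine T.rank_injective (le_antisymm ?_ ?_)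
  · exact T.rank_le_of_mem_bag u v (h ▸ T.self_mem_bag v)
  · exact T.rank_le_of_mem_bag v u (h ▸ T.self_mem_bag u)

theorem parent_induction {P : V → Prop} (hroot : P T.root)
    (hstep : ∀ v, v ≠ T.root → P (T.parent v) → P v) (v : V) : P v := by
  induction hn : T.rank T.root - T.rank v using Nat.strong_induction_on generalizing v with
  | _ n ih =>
  by_cases hv : v = T.root
  · rwa [hv]
  · have h1 := T.rank_lt_parent v hv
    have h2 := T.rank_le_root (T.parent v)
    exact hstep v hv (ih _ (by omega) _ rfl)

theorem eq_root_of_mem_bag_root {u : V} (hu : u ∈ T.bag T.root) : u = T.root :=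
  T.rank_injective (le_antisymm (T.rank_le_root u) (T.rank_le_of_mem_bag _ u hu))

/-- The tree on the vertices of `G` in which every vertex is joined to its parent. -/
def graph : SimpleGraph V where
  Adj u v := u ≠ v ∧ (T.parent u = v ∨ T.parent v = u)
  symm := ⟨fun _ _ h => ⟨h.1.symm, h.2.symm⟩⟩
  loopless := ⟨fun _ h => h.1 rfl⟩

theorem adj_parent {v : V} (hv : v ≠ T.root) : T.graph.Adj v (T.parent v) :=
  ⟨fun h => (T.rank_lt_parent v hv).ne (congrArg T.rank h), Or.inl rfl⟩

theorem eq_parent_of_adj {u v : V} (h : T.graph.Adj u v) (hr : T.rank u ≤ T.rank v) :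
    v = T.parent u := by
  rcases h.2 with h' | h'
  · exact h'.symm
  · by_cases hv : v = T.root
    · rw [hv, T.parent_root] at h'
      exact (h.1 (by rw [hv, h'])).elim
    · have := T.rank_lt_parent v hv
      rw [h'] at this
      omega

/-- Parents lead every vertex to the root. On a cycle, both neighbours of the vertex of least rank
would be its parent. -/
theorem isTree_graph : T.graph.IsTree := by
  classical
  refine ⟨connected_iff_exists_forall_reachable _ |>.2 ⟨T.root, ?_⟩, ?_⟩
  · refine T.parent_induction Reachable.rfl fun v hv h => ?_
    exact h.trans (T.adj_parent hv).symm.reachable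
  · intro v c hc
    obtain ⟨x, hx, hmin⟩ := c.support.toFinset.exists_min_image T.rank
      ⟨v, by simp⟩
    have hx' : x ∈ c.support := by simpa using hx
    have hc' := hc.rotate hx'
    have hmem : ∀ y ∈ (c.rotate x hx').support, T.rank x ≤ T.rank y := by
      intro y hy
      exact hmin y (by simpa [Walk.mem_support_rotate_iff] using hy)
    refine hc'.snd_ne_penultimate ?_
    rw [T.eq_parent_of_adj (Walk.adj_snd hc'.not_nil) (hmem _ (Walk.getVert_mem_support _ _)),
      T.eq_parent_of_adj (Walk.adj_penultimate hc'.not_nil).symm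
        (hmem _ (Walk.getVert_mem_support _ _))]

/-- Climbing along parents keeps `v` in the bag until `v` itself is reached. -/
theorem exists_walk_of_mem_bag (u v : V) (hv : v ∈ T.bag u) :
    ∃ p : T.graph.Walk u v, ∀ x ∈ p.support, v ∈ T.bag x := by
  induction u using T.parent_induction with
  | hroot =>
    obtain rfl := T.eq_root_of_mem_bag_root hv
    exact ⟨.nil, by simpa using hv⟩
  | hstep u hu ih =>
    by_cases h : v = u
    · subst h
      exact ⟨.nil, by simpa using hv⟩
    · obtain ⟨p, hp⟩ := ih (T.mem_bag_parent u v hv h)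
      exact ⟨.cons (T.adj_parent hu) p, by simpa using ⟨hv, hp⟩⟩

/-- The tree path from `u` to `w` is unique, so it lies within the climb from `u` to `v` followed by
the descent to `w`. -/
theorem mem_bag_of_mem_path {u w : V} (p : T.graph.Walk u w) (hp : p.IsPath) {x v : V}
    (hx : x ∈ p.support) (hu : v ∈ T.bag u) (hw : v ∈ T.bag w) : v ∈ T.bag x := by
  classical
  obtain ⟨q, hq⟩ := T.exists_walk_of_mem_bag u v hu
  obtain ⟨r, hr⟩ := T.exists_walk_of_mem_bag w v hw
  have := T.isTree_graph.isAcyclic.subsingleton_path u w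
  have h : p = (q.append r.reverse).bypass :=
    congrArg Subtype.val (Subsingleton.elim (⟨p, hp⟩ : T.graph.Path u w) (q.append r.reverse).toPath)
  rw [h] at hx
  have := Walk.support_bypass_subset_support _ hx
  rw [Walk.mem_support_append_iff, Walk.support_reverse, List.mem_reverse] at this
  exact this.elim (hq x) (hr x)

/-- The tree decomposition whose bags are those of an elimination tree. -/
noncomputable def treeDecomposition [Fintype V] : G.TreeDecomposition := by
  classical
  let e : V ≃ {X : Finset V // X ∈ Finset.univ.image T.bag} :=
    Equiv.ofBijective (fun v => ⟨T.bag v, Finset.mem_image_of_mem _ (Finset.mem_univ v)⟩)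
      ⟨fun u v h => T.bag_injective (congrArg Subtype.val h), fun ⟨X, hX⟩ => by
        obtain ⟨v, -, rfl⟩ := Finset.mem_image.1 hX
        exact ⟨v, rfl⟩⟩
  have he : ∀ X, T.bag (e.symm X) = X.1 := fun X => congrArg Subtype.val (e.apply_symm_apply X)
  let φ : T.graph.comap e.symm ≃g T.graph := Iso.comap e.symm T.graph
  exact
    { bags := Finset.univ.image T.bag
      tree := T.graph.comap e.symm
      isTree := φ.isTree_iff.2 T.isTree_graph
      vertex_mem := fun v => ⟨T.bag v, by simp, T.self_mem_bag v⟩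
      edge_mem := fun u v h => by
        rcases T.adj_mem_bag u v h with h | h
        · exact ⟨T.bag u, by simp, T.self_mem_bag u, h⟩
        · exact ⟨T.bag v, by simp, h, T.self_mem_bag v⟩
      inter_subset := fun X Y Z p hp hY v hX hZ => by
        rw [← he] at hX hZ ⊢
        refine T.mem_bag_of_mem_path (p.map φ.toHom) (hp.map φ.injective) ?_ hX hZ
        rw [Walk.support_map]
        exact List.mem_map_of_mem hY }

theorem bags_treeDecomposition [Fintype V] [DecidableEq V] :
    T.treeDecomposition.bags = Finset.univ.image T.bag := by
  simp only [treeDecomposition]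
  congr!

theorem treewidth_le [Fintype V] {m : ℕ} (h : ∀ v, (T.bag v).card ≤ m + 1) : G.treewidth ≤ m := by
  classical
  have hle : G.treewidth ≤ T.treeDecomposition.width := Nat.sInf_le ⟨T.treeDecomposition, rfl⟩
  refine hle.trans (Finset.sup_le fun X hX => ?_)
  rw [T.bags_treeDecomposition] at hX
  obtain ⟨v, -, rfl⟩ := Finset.mem_image.1 hX
  have := h v
  omega

end EliminationTree

end SimpleGraph

/-! ### Laminar families -/

/-- A laminar family of nonempty subsets of a set with `k` elements has at most `2 * k` members. -/
theorem Finset.card_le_two_mul_of_laminar {α : Type*} (R : Finset α) (L : Finset (Finset α))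
    (hne : ∅ ∉ L) (hsub : ∀ A ∈ L, A ⊆ R)
    (hlam : ∀ A ∈ L, ∀ B ∈ L, A ⊆ B ∨ B ⊆ A ∨ Disjoint A B) : L.card ≤ 2 * R.card := by
  classical
  induction R using Finset.induction_on generalizing L with
  | empty =>
    have : L = ∅ := Finset.eq_empty_of_forall_notMem fun A hA => by
      have := Finset.subset_empty.1 (hsub A hA)
      exact hne (this ▸ hA)
    simp [this]
  | insert x R hx ih =>
    let L' := (L.image (·.erase x)).erase ∅
    have hL' : L'.card ≤ 2 * R.card := by
      refine ih L' (Finset.notMem_erase _ _) ?_ ?_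
      · intro A hA
        obtain ⟨B, hB, rfl⟩ := Finset.mem_image.1 (Finset.mem_of_mem_erase hA)
        rw [← Finset.subset_insert_iff]
        exact hsub B hB
      · intro A' hA' B' hB'
        obtain ⟨A, hA, rfl⟩ := Finset.mem_image.1 (Finset.mem_of_mem_erase hA')
        obtain ⟨B, hB, rfl⟩ := Finset.mem_image.1 (Finset.mem_of_mem_erase hB')
        rcases hlam A hA B hB with h | h | h
        · exact Or.inl (Finset.erase_subset_erase _ h)
        · exact Or.inr (Or.inl (Finset.erase_subset_erase _ h))
        · exact Or.inr (Or.inr (h.mono (Finset.erase_subset _ _) (Finset.erase_subset _ _)))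
    -- Erasing `x` loses at most two members: `{x}`, which becomes empty, and one `A` for which `A`
    -- and `A \ {x}` are both present.
    let L₀ := L.erase {x}
    let bad : Finset α → Prop := fun A => x ∈ A ∧ ∃ B ∈ L₀, x ∉ B ∧ A.erase x = B.erase x
    -- Two bad sets share `x`, hence are nested. If `A ⊆ C`, then `D = C \ {x}` is comparable with
    -- `A` or disjoint from it: `A ⊆ D` fails at `x`, disjointness forces `A = {x}`, and `D ⊆ A`
    -- gives `C ⊆ A`.
    have aux : ∀ A ∈ L₀, ∀ C ∈ L₀, bad A → bad C → C ⊆ A := by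
      rintro A hA C hC ⟨hxA, -⟩ ⟨hxC, D, hD, hxD, hCD⟩
      rw [Finset.erase_eq_of_notMem hxD] at hCD
      rcases hlam C (Finset.mem_of_mem_erase hC) A (Finset.mem_of_mem_erase hA) with h | h | h
      · exact h
      · rcases hlam A (Finset.mem_of_mem_erase hA) D (Finset.mem_of_mem_erase hD) with h' | h' | h'
        · exact (hxD (h' hxA)).elim
        · rw [← Finset.insert_erase hxC, hCD]
          exact Finset.insert_subset hxA h'
        · refine (Finset.ne_of_mem_erase hA (Finset.eq_singleton_iff_unique_mem.2
            ⟨hxA, fun y hy => ?_⟩)).elim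
          by_contra hyx
          have hyD : y ∈ D := hCD ▸ Finset.mem_erase.2 ⟨hyx, h hy⟩
          exact Finset.disjoint_left.1 h' hy hyD
      · exact (Finset.disjoint_left.1 h hxC hxA).elim
    have hbad : (L₀.filter bad).card ≤ 1 := by
      refine Finset.card_le_one.2 fun A hA C hC => ?_
      rw [Finset.mem_filter] at hA hC
      exact Finset.Subset.antisymm (aux C hC.1 A hA.1 hC.2 hA.2) (aux A hA.1 C hC.1 hA.2 hC.2)
    have hgood : (L₀.filter fun A => ¬ bad A).card ≤ L'.card := by
      refine Finset.card_le_card_of_injOn (·.erase x) ?_ ?_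
      · intro A hA
        have hA := (Finset.mem_filter.1 (Finset.mem_coe.1 hA)).1
        refine Finset.mem_coe.2 (Finset.mem_erase.2
          ⟨fun h => ?_, Finset.mem_image_of_mem _ (Finset.mem_of_mem_erase hA)⟩)
        rcases Finset.erase_eq_empty_iff _ _ |>.1 h with h | h
        · exact hne (h ▸ Finset.mem_of_mem_erase hA)
        · exact Finset.ne_of_mem_erase hA h
      · intro A hA B hB hAB
        have hA := Finset.mem_filter.1 (Finset.mem_coe.1 hA)
        have hB := Finset.mem_filter.1 (Finset.mem_coe.1 hB)
        dsimp only at hAB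
        by_cases hxA : x ∈ A <;> by_cases hxB : x ∈ B
        · rw [← Finset.insert_erase hxA, hAB, Finset.insert_erase hxB]
        · exact (hA.2 ⟨hxA, B, hB.1, hxB, hAB⟩).elim
        · exact (hB.2 ⟨hxB, A, hA.1, hxA, hAB.symm⟩).elim
        · rwa [Finset.erase_eq_of_notMem hxA, Finset.erase_eq_of_notMem hxB] at hAB
    have h1 := Finset.card_filter_add_card_filter_not (s := L₀) bad
    have h2 : L.card ≤ L₀.card + 1 := by
      have : L.card - 1 ≤ L₀.card := Finset.pred_card_le_card_erase
      omega
    rw [Finset.card_insert_of_notMem hx]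
    omega

/-! ### Ancestors, traces and separation by two bags -/

namespace SimpleGraph

variable {V : Type u} {G : SimpleGraph V}

namespace EliminationTree

variable (T : G.EliminationTree)

/-- `a` is an ancestor of `v` (possibly `v` itself). -/
def IsAncestor (a v : V) : Prop := ∃ n, T.parent^[n] v = a

variable {T} in
theorem IsAncestor.trans {a b c : V} (h : T.IsAncestor a b) (h' : T.IsAncestor b c) :
    T.IsAncestor a c := by
  obtain ⟨m, rfl⟩ := h
  obtain ⟨n, rfl⟩ := h'
  exact ⟨m + n, Function.iterate_add_apply _ _ _ _⟩

theorem isAncestor_refl (v : V) : T.IsAncestor v v := ⟨0, rfl⟩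

theorem isAncestor_parent (v : V) : T.IsAncestor (T.parent v) v := ⟨1, rfl⟩

theorem isAncestor_root (v : V) : T.IsAncestor T.root v :=
  T.parent_induction (P := fun v => T.IsAncestor T.root v) (T.isAncestor_refl _)
    (fun v _ h => h.trans (T.isAncestor_parent v)) v

variable {T}

theorem IsAncestor.eq_or_parent {a v : V} (h : T.IsAncestor a v) :
    a = v ∨ T.IsAncestor a (T.parent v) := by
  obtain ⟨n, rfl⟩ := h
  cases n with
  | zero => exact Or.inl rfl
  | succ n => exact Or.inr ⟨n, (Function.iterate_succ_apply _ _ _).symm⟩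

theorem IsAncestor.total {a b v : V} (ha : T.IsAncestor a v) (hb : T.IsAncestor b v) :
    T.IsAncestor a b ∨ T.IsAncestor b a := by
  obtain ⟨m, rfl⟩ := ha
  obtain ⟨n, rfl⟩ := hb
  rcases le_total m n with h | h
  · refine Or.inr ⟨n - m, ?_⟩
    rw [← Function.iterate_add_apply, Nat.sub_add_cancel h]
  · refine Or.inl ⟨m - n, ?_⟩
    rw [← Function.iterate_add_apply, Nat.sub_add_cancel h]

theorem rank_le_parent (v : V) : T.rank v ≤ T.rank (T.parent v) := by
  by_cases h : v = T.root
  · rw [h, T.parent_root]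
  · exact (T.rank_lt_parent v h).le

theorem IsAncestor.rank_le {a v : V} (h : T.IsAncestor a v) : T.rank v ≤ T.rank a := by
  obtain ⟨n, rfl⟩ := h
  induction n with
  | zero => exact le_rfl
  | succ n ih =>
    rw [Function.iterate_succ_apply']
    exact ih.trans (rank_le_parent _)

theorem IsAncestor.eq_of_rank_le {a v : V} (h : T.IsAncestor a v) (hr : T.rank a ≤ T.rank v) :
    a = v :=
  T.rank_injective (le_antisymm hr h.rank_le)

theorem IsAncestor.antisymm {a v : V} (h : T.IsAncestor a v) (h' : T.IsAncestor v a) : a = v :=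
  h.eq_of_rank_le h'.rank_le

theorem isAncestor_of_mem_bag {x y : V} (h : y ∈ T.bag x) : T.IsAncestor y x := by
  induction x using T.parent_induction with
  | hroot =>
    rw [T.eq_root_of_mem_bag_root h]
    exact T.isAncestor_refl _
  | hstep x hx ih =>
    by_cases hyx : y = x
    · rw [hyx]
      exact T.isAncestor_refl _
    · exact (ih (T.mem_bag_parent x y h hyx)).trans (T.isAncestor_parent x)

/-- On the climb from `x` to `a`, the vertex `y` could leave the bags only after `y` itself is
passed, but `y` is not below `a`. -/
theorem IsAncestor.mem_bag {a x y : V} (ha : T.IsAncestor a x) (hy : y ∈ T.bag x)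
    (hay : ¬ T.IsAncestor a y) : y ∈ T.bag a := by
  obtain ⟨n, hn⟩ := ha
  induction n generalizing x with
  | zero => exact hn ▸ hy
  | succ n ih =>
    have hyx : y ≠ x := by
      rintro rfl
      exact hay ⟨n + 1, hn⟩
    exact ih (T.mem_bag_parent x y hy hyx) (by rwa [Function.iterate_succ_apply] at hn)

/-- A walk leaving the set of descendants of `a` meets the bag of `a` outside of that set. -/
theorem IsAncestor.exists_mem_support {a v r : V} (hv : T.IsAncestor a v) (hr : ¬ T.IsAncestor a r)
    (p : G.Walk v r) : ∃ z ∈ p.support, z ∈ T.bag a ∧ z ≠ a := by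
  obtain ⟨e, he, hx, hy⟩ := p.exists_boundary_dart {x | T.IsAncestor a x} hv hr
  refine ⟨e.snd, Walk.dart_snd_mem_support_of_mem_darts p he, ?_, ?_⟩
  · rcases T.adj_mem_bag _ _ e.adj with h | h
    · exact IsAncestor.mem_bag hx h hy
    · exact (hy (IsAncestor.trans hx (isAncestor_of_mem_bag h))).elim
  · intro h
    exact hy (h ▸ T.isAncestor_refl _)

variable (T) in
open Classical in
/-- The descendants of `a` in `R`. -/
noncomputable def trace (R : Finset V) (a : V) : Finset V := R.filter fun r => T.IsAncestor a r

theorem mem_trace {R : Finset V} {a r : V} : r ∈ T.trace R a ↔ r ∈ R ∧ T.IsAncestor a r := by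
  simp [trace]

theorem IsAncestor.trace_subset {R : Finset V} {a b : V} (h : T.IsAncestor a b) :
    T.trace R b ⊆ T.trace R a := by
  intro r hr
  rw [mem_trace] at hr ⊢
  exact ⟨hr.1, h.trans hr.2⟩

theorem trace_laminar (R : Finset V) (a b : V) :
    T.trace R a ⊆ T.trace R b ∨ T.trace R b ⊆ T.trace R a ∨
      Disjoint (T.trace R a) (T.trace R b) := by
  by_cases h : Disjoint (T.trace R a) (T.trace R b)
  · exact Or.inr (Or.inr h)
  · obtain ⟨r, hra, hrb⟩ := Finset.not_disjoint_iff.1 h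
    rcases (mem_trace.1 hra).2.total (mem_trace.1 hrb).2 with h | h
    · exact Or.inr (Or.inl h.trace_subset)
    · exact Or.inl h.trace_subset

theorem IsAncestor.total_of_trace_eq {R : Finset V} {a b : V} (hne : (T.trace R a).Nonempty)
    (h : T.trace R a = T.trace R b) : T.IsAncestor a b ∨ T.IsAncestor b a := by
  obtain ⟨r, hr⟩ := hne
  exact (mem_trace.1 hr).2.total (mem_trace.1 (h ▸ hr)).2

/-- The vertices with a given nonempty trace form a path from a top to a bottom vertex. -/
theorem exists_top_bottom [Finite V] {R : Finset V} {a : V} (hne : (T.trace R a).Nonempty) :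
    ∃ t b, T.trace R t = T.trace R a ∧ T.trace R b = T.trace R a ∧
      ∀ u, T.trace R u = T.trace R a → T.IsAncestor t u ∧ T.IsAncestor u b := by
  obtain ⟨t, ht, htmax⟩ := (Set.toFinite {u | T.trace R u = T.trace R a}).exists_maximalFor
    T.rank _ ⟨a, rfl⟩
  obtain ⟨b, hb, hbmin⟩ := (Set.toFinite {u | T.trace R u = T.trace R a}).exists_minimalFor
    T.rank _ ⟨a, rfl⟩
  simp only [Set.mem_ofPred_eq] at ht hb htmax hbmin
  refine ⟨t, b, ht, hb, fun u hu => ⟨?_, ?_⟩⟩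
  · rcases IsAncestor.total_of_trace_eq (ht ▸ hne) (ht.trans hu.symm) with h | h
    · exact h
    · rw [h.eq_of_rank_le (htmax hu h.rank_le)]
      exact T.isAncestor_refl _
  · rcases IsAncestor.total_of_trace_eq (hu ▸ hne) (hu.trans hb.symm) with h | h
    · exact h
    · rw [← h.eq_of_rank_le (hbmin hu h.rank_le)]
      exact T.isAncestor_refl _

variable (T) in
theorem exists_isAncestor_trace_nonempty {R : Finset V} (hR : R.Nonempty) (v : V) :
    ∃ u, T.IsAncestor u v ∧ (T.trace R u).Nonempty ∧
      (u = v ∨ ∃ c, T.IsAncestor c v ∧ T.parent c = u ∧ T.trace R c = ∅) := by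
  classical
  have hex : ∃ n, (T.trace R (T.parent^[n] v)).Nonempty := by
    obtain ⟨n, hn⟩ := T.isAncestor_root v
    obtain ⟨r, hr⟩ := hR
    exact ⟨n, r, mem_trace.2 ⟨hr, hn ▸ T.isAncestor_root r⟩⟩
  refine ⟨T.parent^[Nat.find hex] v, ⟨_, rfl⟩, Nat.find_spec hex, ?_⟩
  cases hn : Nat.find hex with
  | zero => exact Or.inl rfl
  | succ n =>
    refine Or.inr ⟨T.parent^[n] v, ⟨_, rfl⟩, (Function.iterate_succ_apply' _ _ _).symm, ?_⟩
    exact Finset.not_nonempty_iff_eq_empty.1 (Nat.find_min hex (by omega))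

variable (T) in
/-- The vertices of `G` fall into at most `2 * |R|` classes, each of which is separated from `R` by
the union of two bags. -/
theorem exists_classes [Finite V] {R : Finset V} (hR : R.Nonempty) :
    ∃ (L : Finset (Finset V)) (σ : V → Finset V) (t b : Finset V → V), L.card ≤ 2 * R.card ∧
      (∀ v, σ v ∈ L) ∧ ∀ v, ∀ r ∈ R, ∀ p : G.Walk v r,
        ∃ z ∈ p.support, z ∈ T.bag (t (σ v)) ∨ z ∈ T.bag (b (σ v)) := by
  classical
  have := Fintype.ofFinite V
  have hchoose : ∀ A : Finset V, ∃ t b, A.Nonempty → (∃ a, T.trace R a = A) →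
      T.trace R t = A ∧ T.trace R b = A ∧
        ∀ u, T.trace R u = A → T.IsAncestor t u ∧ T.IsAncestor u b := by
    intro A
    by_cases h : A.Nonempty ∧ ∃ a, T.trace R a = A
    · obtain ⟨hne, a, rfl⟩ := h
      obtain ⟨t, b, htb⟩ := exists_top_bottom hne
      exact ⟨t, b, fun _ _ => htb⟩
    · exact ⟨T.root, T.root, fun h1 h2 => (h ⟨h1, h2⟩).elim⟩
  choose t b htb using hchoose
  choose u huv hune hu using T.exists_isAncestor_trace_nonempty hR
  refine ⟨(Finset.univ.image (T.trace R)).erase ∅, fun v => T.trace R (u v), t, b, ?_, ?_, ?_⟩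
  · refine Finset.card_le_two_mul_of_laminar _ _ (Finset.notMem_erase _ _) ?_ ?_
    · intro A hA r hr
      obtain ⟨a, -, rfl⟩ := Finset.mem_image.1 (Finset.mem_of_mem_erase hA)
      exact (mem_trace.1 hr).1
    · intro A hA B hB
      obtain ⟨a, -, rfl⟩ := Finset.mem_image.1 (Finset.mem_of_mem_erase hA)
      obtain ⟨c, -, rfl⟩ := Finset.mem_image.1 (Finset.mem_of_mem_erase hB)
      exact trace_laminar R a c
  · intro v
    exact Finset.mem_erase.2 ⟨(hune v).ne_empty, Finset.mem_image_of_mem _ (Finset.mem_univ _)⟩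
  · intro v r hr p
    obtain ⟨ht, hb, hall⟩ := htb _ (hune v) ⟨u v, rfl⟩
    dsimp only
    set A := T.trace R (u v) with hA
    by_cases hrA : r ∈ A
    · have hbr : T.IsAncestor (b A) r := (mem_trace.1 (hb ▸ hrA)).2
      suffices ∃ z ∈ p.support, z ∈ T.bag (b A) from
        let ⟨z, hz, hzb⟩ := this; ⟨z, hz, Or.inr hzb⟩
      -- If `v` is also below `b A`, then `b A` is `u v`. Either `v = u v`, or the child `c` of `u
      -- v` towards `v` has no resolving vertex below it; a walk to `r` then leaves the subtree of
      -- `c` through `bag c` minus `c`, which lies in the bag of `b A`.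
      by_cases hbv : T.IsAncestor (b A) v
      · have hub := (hall (u v) rfl).2
        rcases hu v with h | ⟨c, hcv, hcu, hc⟩
        · rw [h] at hub
          exact ⟨v, p.start_mem_support, hub.antisymm hbv ▸ T.self_mem_bag v⟩
        · have hcb : ¬ T.IsAncestor c (b A) := by
            intro h
            have := h.trace_subset (R := R)
            rw [hb, hc] at this
            exact (hune v).ne_empty (Finset.subset_empty.1 this)
          have hbc : T.IsAncestor (b A) c := (hcv.total hbv).resolve_left hcb
          have hbu : b A = u v := by
            rcases hbc.eq_or_parent with h | h
            · exact (hcb (h ▸ T.isAncestor_refl _)).elim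
            · rw [hcu] at h
              exact h.antisymm hub
          have hcr : ¬ T.IsAncestor c r := fun h => by
            have : r ∈ T.trace R c := mem_trace.2 ⟨hr, h⟩
            simp [hc] at this
          obtain ⟨z, hz, hzc, hne⟩ := hcv.exists_mem_support hcr p
          refine ⟨z, hz, ?_⟩
          rw [hbu, ← hcu]
          exact T.mem_bag_parent c z hzc hne
      · obtain ⟨z, hz, hzb, -⟩ := hbr.exists_mem_support hbv p.reverse
        exact ⟨z, by simpa using hz, hzb⟩
    -- Here `r` is not below the top node but `v` is, so the walk crosses the bag of `t A`.
    · have htv : T.IsAncestor (t A) v := (hall (u v) rfl).1.trans (huv v)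
      have htr : ¬ T.IsAncestor (t A) r := fun h => hrA (ht ▸ mem_trace.2 ⟨hr, h⟩)
      obtain ⟨z, hz, hzt, -⟩ := htv.exists_mem_support htr p
      exact ⟨z, hz, Or.inl hzt⟩

end EliminationTree

/-! ### Counting by distance profiles -/

/-- The distances from a vertex to the members of a clique are encoded by their minimum and the
set on which it is attained. -/
theorem IsClique.exists_profile {K : Finset V} (hK : G.IsClique (K : Set V)) {d : ℕ}
    (hd : ∀ u v, G.dist u v ≤ d) :
    ∃ prof : V → ℕ × Finset V, (∀ v, prof v ∈ Finset.range (d + 1) ×ˢ K.powerset) ∧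
      ∀ v v', prof v = prof v' → ∀ z ∈ K, G.dist v z = G.dist v' z := by
  classical
  choose m hm hm' using hK.exists_dist
  refine ⟨fun v => (m v, K.filter fun z => G.dist v z = m v), fun v => ?_, ?_⟩
  · rw [Finset.mem_product, Finset.mem_range, Finset.mem_powerset]
    refine ⟨?_, Finset.filter_subset _ _⟩
    rcases hm v with h | ⟨z, -, h⟩
    · simp [h]
    · have := hd v z
      dsimp only
      omega
  · intro v v' h z hz
    obtain ⟨h1, h2⟩ := Prod.mk.inj h
    have h3 : G.dist v z = m v ↔ G.dist v' z = m v' := by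
      have := congrArg (z ∈ ·) h2
      simpa [hz] using this
    have h4 := hm' v z hz
    have h5 := hm' v' z hz
    omega

/-- A shortest walk from `v` to `r` meets `K` at some `z`; its initial part can be replaced by an
equally short one from `v'`. -/
theorem Connected.dist_le_of_forall_walk (hG : G.Connected) {K : Finset V} {v v' r : V}
    (hK : ∀ p : G.Walk v r, ∃ z ∈ p.support, z ∈ K)
    (h : ∀ z ∈ K, G.dist v z = G.dist v' z) : G.dist v' r ≤ G.dist v r := by
  classical
  obtain ⟨p, hp⟩ := hG.exists_walk_length_eq_dist v r
  obtain ⟨z, hz, hzK⟩ := hK p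
  have h1 := congrArg Walk.length (p.take_spec hz)
  rw [Walk.length_append] at h1
  have h2 := dist_le (p.takeUntil z hz)
  have h3 := dist_le (p.dropUntil z hz)
  have h4 := hG.dist_triangle (u := v') (v := z) (w := r)
  have h5 := h z hzK
  omega

/-- The order of a connected graph with an elimination tree with bags of size at most `s`. -/
theorem EliminationTree.card_le [Fintype V] (T : G.EliminationTree) (hG : G.Connected)
    {R : Finset V} (hR : G.IsResolvingSet R) (hne : R.Nonempty) {d s : ℕ}
    (hd : ∀ u v, G.dist u v ≤ d) (hs : ∀ v, (T.bag v).card ≤ s) :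
    Fintype.card V ≤ ((d + 1) * 2 ^ s) ^ 2 * (2 * R.card) := by
  classical
  obtain ⟨L, σ, t, b, hL, hσ, hsep⟩ := T.exists_classes hne
  refine le_trans ?_ (Nat.mul_le_mul_left _ hL)
  rw [← Finset.card_univ]
  refine Finset.card_le_mul_card_image_of_maps_to (f := σ) (fun v _ => hσ v) _ fun A _ => ?_
  obtain ⟨f, hf, hf'⟩ := (T.isClique_bag (t A)).exists_profile hd
  obtain ⟨g, hg, hg'⟩ := (T.isClique_bag (b A)).exists_profile hd
  have hcard : ∀ v, (Finset.range (d + 1) ×ˢ (T.bag v).powerset).card ≤ (d + 1) * 2 ^ s := by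
    intro v
    rw [Finset.card_product, Finset.card_range, Finset.card_powerset]
    exact Nat.mul_le_mul_left _ (Nat.pow_le_pow_right (by norm_num) (hs v))
  refine le_trans (Finset.card_le_card_of_injOn
    (t := (Finset.range (d + 1) ×ˢ (T.bag (t A)).powerset) ×ˢ
      (Finset.range (d + 1) ×ˢ (T.bag (b A)).powerset)) (fun v => (f v, g v))
    (fun v _ => Finset.mem_coe.2 (Finset.mem_product.2 ⟨hf v, hg v⟩)) ?_) ?_
  · have key : ∀ v v', σ v = A → f v = f v' → g v = g v' → ∀ r ∈ R, G.dist v' r ≤ G.dist v r := by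
      intro v v' hv h1 h2 r hr
      refine hG.dist_le_of_forall_walk (K := T.bag (t A) ∪ T.bag (b A)) (fun p => ?_) ?_
      · obtain ⟨z, hz, h⟩ := hsep v r hr p
        rw [hv] at h
        exact ⟨z, hz, Finset.mem_union.2 h⟩
      · intro z hz
        exact (Finset.mem_union.1 hz).elim (hf' v v' h1 z) (hg' v v' h2 z)
    intro v hv v' hv' h
    obtain ⟨h1, h2⟩ := Prod.mk.inj h
    have hv := (Finset.mem_filter.1 (Finset.mem_coe.1 hv)).2
    have hv' := (Finset.mem_filter.1 (Finset.mem_coe.1 hv')).2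
    by_contra hvv
    obtain ⟨r, hr, hrd⟩ := hR v v' hvv
    rw [dist_comm, dist_comm (v := v')] at hrd
    exact hrd (le_antisymm (key v' v hv' h1.symm h2.symm r hr) (key v v' hv h1 h2 r hr))
  · rw [Finset.card_product, sq]
    exact Nat.mul_le_mul (hcard _) (hcard _)

theorem IsChordal.card_le_and_treewidth_le [Fintype V] (hG : G.IsChordal) (hc : G.Connected)
    (hV : 2 ≤ Fintype.card V) {R : Finset V} (hR : G.IsResolvingSet R) :
    Fintype.card V ≤ 32 * (R.card * G.diam ^ 2 * 3 ^ (3 * G.treewidth + 1)) ∧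
      G.treewidth ≤ 3 ^ R.card ∧ R.Nonempty := by
  classical
  have := hc.nonempty
  obtain ⟨T⟩ := hG.nonempty_eliminationTree
  have : Nonempty G.TreeDecomposition := ⟨T.treeDecomposition⟩
  obtain ⟨x, y, hxy⟩ := Fintype.one_lt_card_iff.1 hV
  have hne : R.Nonempty := by
    obtain ⟨r, hr, -⟩ := hR x y hxy
    exact ⟨r, hr⟩
  have hd : ∀ u v, G.dist u v ≤ G.diam := fun u v => dist_le_diam (connected_iff_ediam_ne_top.1 hc)
  have hd1 : 1 ≤ G.diam := (hc.pos_dist_of_ne hxy).trans_le (hd x y)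
  refine ⟨?_, ?_, hne⟩
  · refine (T.card_le hc hR hne hd fun v => card_le_treewidth_add_one (T.isClique_bag v)).trans ?_
    -- The constant 32 comes from `d + 1 ≤ 2 * d`, valid as `d ≥ 1`: the square contributes `(2 * 2)
    -- ^ 2 = 16` and the number of classes a further 2.
    have h1 : ((G.diam + 1) * 2 ^ (G.treewidth + 1)) ^ 2 ≤
        (2 * G.diam * 2 ^ (G.treewidth + 1)) ^ 2 :=
      Nat.pow_le_pow_left (Nat.mul_le_mul_right _ (by omega)) 2
    have h2 : (2 ^ G.treewidth) ^ 2 ≤ 3 ^ (3 * G.treewidth + 1) := by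
      rw [← pow_mul]
      exact (Nat.pow_le_pow_left (by norm_num : 2 ≤ 3) _).trans
        (Nat.pow_le_pow_right (by norm_num) (by omega))
    calc ((G.diam + 1) * 2 ^ (G.treewidth + 1)) ^ 2 * (2 * R.card)
        ≤ (2 * G.diam * 2 ^ (G.treewidth + 1)) ^ 2 * (2 * R.card) := Nat.mul_le_mul_right _ h1
      _ = 32 * (R.card * G.diam ^ 2 * (2 ^ G.treewidth) ^ 2) := by ring
      _ ≤ _ := Nat.mul_le_mul_left _ (Nat.mul_le_mul_left _ h2)
  · refine (T.treewidth_le fun v => ?_).trans (Nat.pow_le_pow_left (by norm_num : 2 ≤ 3) _)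
    exact (hR.card_clique_le (T.isClique_bag v)).trans (Nat.le_succ _)

end SimpleGraph

/-! ### Arithmetic of the double exponential bound -/

theorem mul_three_pow_le_two_pow_two_pow {k w : ℕ} (hk : 1 ≤ k) (hw : w ≤ 3 ^ k) :
    k * 3 ^ (3 * w + 1) ≤ 2 ^ 2 ^ (5 * k) := by
  have h1 : k ≤ 2 ^ 3 ^ k :=
    ((Nat.lt_pow_self (by norm_num : 1 < 3)).trans (Nat.lt_pow_self (by norm_num : 1 < 2))).le
  have h2 : 3 ^ (3 * w + 1) ≤ 2 ^ (6 * 3 ^ k + 2) :=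
    calc 3 ^ (3 * w + 1) ≤ 4 ^ (3 * w + 1) := Nat.pow_le_pow_left (by norm_num) _
      _ = 2 ^ (2 * (3 * w + 1)) := by rw [pow_mul]; norm_num
      _ ≤ _ := Nat.pow_le_pow_right (by norm_num) (by omega)
  have h3 : 3 ≤ 3 ^ k := Nat.le_self_pow (by omega) 3
  -- The exponent is `7 * 3 ^ k + 2 ≤ 8 * 3 ^ k ≤ 2 ^ (2 * k + 3)`, and `2 * k + 3 ≤ 5 * k` since `k
  -- ≥ 1`.
  have h4 : 3 ^ k + (6 * 3 ^ k + 2) ≤ 2 ^ (5 * k) := by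
    have h5 : 3 ^ k ≤ 2 ^ (2 * k) := by
      rw [pow_mul]
      exact Nat.pow_le_pow_left (by norm_num) _
    have h6 : 2 ^ 4 * 2 ^ (2 * k) ≤ 2 ^ (5 * k) * 2 := by
      rw [← pow_add, ← pow_succ]
      exact Nat.pow_le_pow_right (by norm_num) (by omega)
    omega
  calc k * 3 ^ (3 * w + 1) ≤ 2 ^ 3 ^ k * 2 ^ (6 * 3 ^ k + 2) := Nat.mul_le_mul h1 h2
    _ = 2 ^ (3 ^ k + (6 * 3 ^ k + 2)) := (pow_add _ _ _).symm
    _ ≤ _ := Nat.pow_le_pow_right (by norm_num) h4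

theorem corollary2 :
    (∃ C : ℕ, ∀ (V : Type u) [Fintype V] (G : SimpleGraph V) (d w k : ℕ) (R : Finset V),
      2 ≤ Fintype.card V → G.Connected → G.IsChordal → G.diam = d → G.treewidth = w →
      G.IsResolvingSet R → R.card = k →
        Fintype.card V ≤ C * (k * d ^ 2 * 3 ^ (3 * w + 1)) ∧ w ≤ 3 ^ k) ∧
    (∃ C c : ℕ, ∀ (V : Type u) [Fintype V] (G : SimpleGraph V) (d k : ℕ) (R : Finset V),
      2 ≤ Fintype.card V → G.Connected → G.IsChordal → G.diam = d →
      G.IsResolvingSet R → R.card = k →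
        Fintype.card V ≤ C * (d ^ 2 * 2 ^ (2 ^ (c * k)))) := by
  refine ⟨⟨32, ?_⟩, ⟨32, 5, ?_⟩⟩
  · rintro V _ G d w k R hV hc hG rfl rfl hR rfl
    obtain ⟨h1, h2, -⟩ := hG.card_le_and_treewidth_le hc hV hR
    exact ⟨h1, h2⟩
  · rintro V _ G d k R hV hc hG rfl hR rfl
    obtain ⟨h1, h2, h3⟩ := hG.card_le_and_treewidth_le hc hV hR
    refine h1.trans (Nat.mul_le_mul_left _ ?_)
    rw [mul_comm R.card, mul_assoc]
    exact Nat.mul_le_mul_left _ (mul_three_pow_le_two_pow_two_pow h3.card_pos h2)
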